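/- Let $\Delta=\{z\in\mathbb C:|z|<1\}$. For a weight $v$ on $\Delta$ (a continuous, bounded, strictly positive function), let $\mathcal H_v(\Delta)$ be the space of all holomorphic $f:\Delta\to\mathbb C$ with $\|f\|_v:=\sup_{z\in\Delta}v(z)|f(z)|<\infty$, and let $\mathcal H_{v_o}(\Delta)$ be its subspace, with the same norm, of those $f$ such that for every $\varepsilon>0$ there is a compact set $K\subset\Delta$ with $v(z)|f(z)|<\varepsilon$ for all $z\in\Delta\setminus K$. Theorem 5.5. Let $v(z)=1-|z|$ and $w(z)=1-|z|^2$ on $\Delta$. (i) The map $S(f)(z)=f(z^2)$ is a non-surjective linear isometry from $\mathcal H_{v_o}(\Delta)$ into $\mathcal H_{w_o}(\Delta)$. (ii) For every (complex) linear isometry $T:\mathcal H_{v_o}(\Delta)\to\mathcal H_{w_o}(\Delta)$, not assumed surjective, there are a constant $c\in\mathbb C$ with $|c|=1$ and an automorphism $\psi$ of $\Delta$ (a biholomorphic map of $\Delta$ onto itself) such that $$T(f)(z)=c\,\psi'(z)\,f(\psi(z)^2)\qquad\text{for all } f\in\mathcal H_{v_o}(\Delta),\ z\in\Delta .$$ That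 is, $T(f)=c\,\psi'\cdot\big(S(f)\circ\psi\big)$. -/

import Mathlib

noncomputable section

/-- A weight on `U`: a continuous, bounded, strictly positive real function on `U`. -/
structure Weight (U : Set ℂ) where
  toFun : U → ℝ
  continuous_toFun : Continuous toFun
  bounded_toFun : BddAbove (Set.range toFun)
  pos : ∀ z, 0 < toFun z

instance (U : Set ℂ) : CoeFun (Weight U) (fun _ => U → ℝ) := ⟨Weight.toFun⟩

/-- Extension by zero of a function on `U`; only its values on `U` matter below, as `U` is open. -/
def extendZero {U : Set ℂ} (f : U → ℂ) : ℂ → ℂ := Function.extend Subtype.val f 0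

theorem extendZero_apply {U : Set ℂ} (f : U → ℂ) (z : U) : extendZero f z = f z :=
  Subtype.val_injective.extend_apply f 0 z

/-- `f` is holomorphic on the open set `U`. -/
def IsHolomorphic {U : Set ℂ} (f : U → ℂ) : Prop := DifferentiableOn ℂ (extendZero f) U

/-- The complex derivative of a holomorphic function `f` on the open set `U`, at a point of `U`. -/
def holDeriv {U : Set ℂ} (f : U → ℂ) (z : U) : ℂ := deriv (extendZero f) (z : ℂ)

variable {U : Set ℂ}

theorem IsHolomorphic.congr_ext {f : U → ℂ} {g : ℂ → ℂ} (hg : DifferentiableOn ℂ g U)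
    (h : ∀ z : U, f z = g z) : IsHolomorphic f :=
  DifferentiableOn.congr hg fun z hz => (extendZero_apply f ⟨z, hz⟩).trans (h ⟨z, hz⟩)

/-- The vector space underlying `H_v(U)`: the holomorphic functions `f` on `U` for which
`v |f|` is bounded. -/
def weightedSubmodule (v : Weight U) : Submodule ℂ (U → ℂ) where
  carrier := {f | IsHolomorphic f ∧ BddAbove (Set.range fun z => v z * ‖f z‖)}
  zero_mem' := by
    refine ⟨IsHolomorphic.congr_ext (g := 0) (differentiableOn_const 0) fun z => rfl, 0, ?_⟩
    rintro _ ⟨z, rfl⟩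
    simp
  add_mem' := by
    rintro f g ⟨hf, A, hA⟩ ⟨hg, B, hB⟩
    refine ⟨IsHolomorphic.congr_ext (hf.add hg) fun z => by simp [extendZero_apply],
      A + B, ?_⟩
    rintro _ ⟨z, rfl⟩
    have h1 := hA ⟨z, rfl⟩
    have h2 := hB ⟨z, rfl⟩
    have h3 := mul_le_mul_of_nonneg_left (norm_add_le (f z) (g z)) (v.pos z).le
    simp only [Pi.add_apply] at *
    linarith
  smul_mem' := by
    rintro c f ⟨hf, A, hA⟩
    refine ⟨IsHolomorphic.congr_ext (hf.const_smul c) fun z => by simp [extendZero_apply],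
      ‖c‖ * A, ?_⟩
    rintro _ ⟨z, rfl⟩
    have h1 := mul_le_mul_of_nonneg_left (hA ⟨z, rfl⟩) (norm_nonneg c)
    simp only [Pi.smul_apply, smul_eq_mul, norm_mul] at *
    linarith

/-- The weighted space `H_v(U)`. It is a type of its own, so that it carries only the topology
of its norm and not that of pointwise convergence. -/
def WeightedH (v : Weight U) : Type := weightedSubmodule v

instance (v : Weight U) : AddCommGroup (WeightedH v) := inferInstanceAs (AddCommGroup (weightedSubmodule v))

instance (v : Weight U) : Module ℂ (WeightedH v) := inferInstanceAs (Module ℂ (weightedSubmodule v))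

instance (v : Weight U) : CoeFun (WeightedH v) (fun _ => U → ℂ) := ⟨fun f => f.1⟩

namespace WeightedH

variable {v : Weight U}

theorem add_apply (f g : WeightedH v) (z : U) : (f + g) z = f z + g z := rfl

theorem neg_apply (f : WeightedH v) (z : U) : (-f) z = -f z := rfl

theorem zero_apply (z : U) : (0 : WeightedH v) z = 0 := rfl

theorem smul_apply (c : ℂ) (f : WeightedH v) (z : U) : (c • f) z = c * f z := rfl

/-- The norm `‖f‖_v = sup_{z ∈ U} v(z) |f(z)|`. -/
instance : Norm (WeightedH v) := ⟨fun f => ⨆ z, v z * ‖f z‖⟩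

theorem norm_def (f : WeightedH v) : ‖f‖ = ⨆ z, v z * ‖f z‖ := rfl

theorem le_norm (f : WeightedH v) (z : U) : v z * ‖f z‖ ≤ ‖f‖ := le_ciSup f.2.2 z

theorem norm_nonneg' (f : WeightedH v) : 0 ≤ ‖f‖ :=
  Real.iSup_nonneg fun z => mul_nonneg (v.pos z).le (norm_nonneg _)

theorem norm_le {f : WeightedH v} {C : ℝ} (hC : 0 ≤ C) (h : ∀ z, v z * ‖f z‖ ≤ C) : ‖f‖ ≤ C :=
  Real.iSup_le h hC

theorem core : NormedSpace.Core ℂ (WeightedH v) where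
  norm_nonneg := norm_nonneg'
  norm_smul c f := by
    rw [norm_def, norm_def, Real.mul_iSup_of_nonneg (norm_nonneg c)]
    congr 1
    funext z
    rw [smul_apply, norm_mul]
    ring
  norm_triangle f g := by
    refine norm_le (add_nonneg (norm_nonneg' f) (norm_nonneg' g)) fun z => ?_
    have h1 := le_norm f z
    have h2 := le_norm g z
    have h3 := mul_le_mul_of_nonneg_left (norm_add_le (f z) (g z)) (v.pos z).le
    rw [add_apply]
    linarith
  norm_eq_zero_iff f := by
    constructor
    · intro h
      refine Subtype.ext (funext fun z => ?_)
      have h1 := le_norm f z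
      rw [h] at h1
      have h2 : ‖f z‖ ≤ 0 := nonpos_of_mul_nonpos_right h1 (v.pos z)
      exact norm_le_zero_iff.mp h2
    · rintro rfl
      refine le_antisymm (norm_le le_rfl fun z => ?_) (norm_nonneg' 0)
      simp [zero_apply]

instance : NormedAddCommGroup (WeightedH v) := NormedAddCommGroup.ofCore core

instance : NormedSpace ℂ (WeightedH v) := NormedSpace.ofCore core

end WeightedH

/-- The subspace `H_{v_o}(U)` of `H_v(U)`, with the norm of `H_v(U)`: the functions `f` for which
`v |f|` tends to `0` at the boundary of `U`, that is, for every `ε > 0` there is a compact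
`K ⊆ U` with `v |f| < ε` on `U \ K`. -/
def LittleWeightedH (v : Weight U) : Submodule ℂ (WeightedH v) where
  carrier := {f | ∀ ε > 0, ∃ K : Set U, IsCompact K ∧ ∀ z ∉ K, v z * ‖f z‖ < ε}
  zero_mem' := fun ε hε => ⟨∅, isCompact_empty, fun z _ => by simpa [WeightedH.zero_apply] using hε⟩
  add_mem' := by
    intro f g hf hg ε hε
    obtain ⟨K, hK, hf⟩ := hf (ε / 2) (half_pos hε)
    obtain ⟨L, hL, hg⟩ := hg (ε / 2) (half_pos hε)
    refine ⟨K ∪ L, hK.union hL, fun z hz => ?_⟩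
    have h1 := hf z fun h => hz (Or.inl h)
    have h2 := hg z fun h => hz (Or.inr h)
    have h3 := mul_le_mul_of_nonneg_left (norm_add_le (f z) (g z)) (v.pos z).le
    rw [WeightedH.add_apply]
    linarith
  smul_mem' := by
    intro c f hf ε hε
    have hc : 0 < ‖c‖ + 1 := by positivity
    obtain ⟨K, hK, hf⟩ := hf (ε / (‖c‖ + 1)) (div_pos hε hc)
    refine ⟨K, hK, fun z hz => ?_⟩
    have h1 := (lt_div_iff₀ hc).mp (hf z hz)
    have h2 : 0 ≤ v z * ‖f z‖ := mul_nonneg (v.pos z).le (norm_nonneg _)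
    rw [WeightedH.smul_apply, norm_mul]
    linarith

instance (v : Weight U) : CoeFun (LittleWeightedH v) (fun _ => U → ℂ) := ⟨fun f => f.1.1⟩

/-- The open unit disc `Δ`. -/
abbrev unitDisc : Set ℂ := Metric.ball 0 1

theorem norm_lt_one_of_disc (z : unitDisc) : ‖(z : ℂ)‖ < 1 := mem_ball_zero_iff.mp z.2

/-- The weight `v(z) = 1 - |z|` on the disc. -/
def discWeight : Weight unitDisc where
  toFun z := 1 - ‖(z : ℂ)‖
  continuous_toFun := by fun_prop
  bounded_toFun := by
    refine ⟨1, ?_⟩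
    rintro _ ⟨z, rfl⟩
    simp
  pos z := sub_pos.mpr (norm_lt_one_of_disc z)

/-- The weight `w(z) = 1 - |z|^2` on the disc. -/
def discWeightSq : Weight unitDisc where
  toFun z := 1 - ‖(z : ℂ)‖ ^ 2
  continuous_toFun := by fun_prop
  bounded_toFun := by
    refine ⟨1, ?_⟩
    rintro _ ⟨z, rfl⟩
    simp
  pos z := sub_pos.mpr (pow_lt_one₀ (norm_nonneg _) (norm_lt_one_of_disc z) two_ne_zero)

/-- The squaring map `z ↦ z^2` of the disc into itself. -/
def discSq (z : unitDisc) : unitDisc :=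
  ⟨(z : ℂ) ^ 2, by
    rw [mem_ball_zero_iff, norm_pow]
    exact pow_lt_one₀ (norm_nonneg _) (norm_lt_one_of_disc z) two_ne_zero⟩

/-- An automorphism of the disc: a bijection of the disc onto itself that is holomorphic and has
a holomorphic inverse. -/
structure DiscAut extends unitDisc ≃ unitDisc where
  holomorphic_toFun : IsHolomorphic fun z => (toFun z : ℂ)
  holomorphic_invFun : IsHolomorphic fun z => (invFun z : ℂ)

instance : CoeFun DiscAut (fun _ => unitDisc → unitDisc) := ⟨fun ψ => ψ.toFun⟩

/-- The derivative `ψ'` of an automorphism `ψ` of the disc. -/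
def DiscAut.derivative (ψ : DiscAut) (z : unitDisc) : ℂ := holDeriv (fun u => (ψ u : ℂ)) z

end

open Filter Topology ComplexConjugate

noncomputable section

/-! ### Weighted spaces of holomorphic functions -/

theorem IsHolomorphic.continuous {U : Set ℂ} {f : U → ℂ} (hf : IsHolomorphic f) :
    Continuous f := by
  have h := continuousOn_iff_continuous_domRestrict.mp (DifferentiableOn.continuousOn hf)
  exact h.congr fun z => extendZero_apply f z

namespace LittleWeightedH

variable {U : Set ℂ} {v : Weight U}

theorem norm_def (f : LittleWeightedH v) : ‖f‖ = ⨆ z, v z * ‖f z‖ := rfl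

theorem isHolomorphic (f : LittleWeightedH v) : IsHolomorphic f.1.1 := f.1.2.1

theorem le_norm (f : LittleWeightedH v) (z : U) : v z * ‖f z‖ ≤ ‖f‖ := WeightedH.le_norm f.1 z

theorem norm_le {f : LittleWeightedH v} {C : ℝ} (hC : 0 ≤ C) (h : ∀ z, v z * ‖f z‖ ≤ C) :
    ‖f‖ ≤ C := WeightedH.norm_le (f := f.1) hC h

theorem continuous_weight_mul (f : LittleWeightedH v) : Continuous fun z => v z * ‖f z‖ :=
  v.continuous_toFun.mul (isHolomorphic f).continuous.norm

theorem add_apply (f g : LittleWeightedH v) (z : U) : (f + g) z = f z + g z := rfl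

theorem sub_apply (f g : LittleWeightedH v) (z : U) : (f - g) z = f z - g z := by
  rw [sub_eq_add_neg, sub_eq_add_neg]; rfl

theorem smul_apply (c : ℂ) (f : LittleWeightedH v) (z : U) : (c • f) z = c * f z := rfl

/-- Away from a neighbourhood of the set where the weighted modulus attains its maximum, it stays
bounded away from the maximum. -/
theorem exists_bound_lt_of_isClosed {f : LittleWeightedH v} (hf : 0 < ‖f‖) {A : Set U}
    (hA : IsClosed A) (h : ∀ z ∈ A, v z * ‖f z‖ < ‖f‖) :
    ∃ m < ‖f‖, ∀ z ∈ A, v z * ‖f z‖ ≤ m := by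
  obtain ⟨K, hK, hKf⟩ := f.2 (‖f‖ / 2) (half_pos hf)
  rcases (K ∩ A).eq_empty_or_nonempty with he | hne
  · refine ⟨‖f‖ / 2, half_lt_self hf, fun z hz => (hKf z fun hzK => ?_).le⟩
    exact (Set.mem_empty_iff_false z).mp (he ▸ ⟨hzK, hz⟩)
  · obtain ⟨x, hx, hmax⟩ := (hK.inter_right hA).exists_isMaxOn hne
      (continuous_weight_mul f).continuousOn
    refine ⟨max (‖f‖ / 2) (v x * ‖f x‖), max_lt (half_lt_self hf) (h x hx.2), fun z hz => ?_⟩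
    by_cases hzK : z ∈ K
    · exact le_max_of_le_right (isMaxOn_iff.mp hmax z ⟨hzK, hz⟩)
    · exact le_max_of_le_left (hKf z hzK).le

/-- The norm of a function in the little weighted space is attained. -/
theorem exists_norm_eq {f : LittleWeightedH v} (hf : 0 < ‖f‖) : ∃ z, v z * ‖f z‖ = ‖f‖ := by
  by_contra! h
  obtain ⟨m, hm, hb⟩ := exists_bound_lt_of_isClosed hf isClosed_univ
    fun z _ => lt_of_le_of_ne (le_norm f z) (h z)
  have h1 : ‖f‖ ≤ max m 0 :=
    norm_le (le_max_right _ _) fun z => (hb z trivial).trans (le_max_left _ _)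
  exact absurd h1 (not_le.mpr (max_lt hm hf))

/-- `f` peaks at `p`. -/
def PeaksAt (f : LittleWeightedH v) (p : U) : Prop :=
  ∀ z, z ≠ p → v z * ‖f z‖ < v p * ‖f p‖

theorem PeaksAt.norm_eq {f : LittleWeightedH v} {p : U} (h : PeaksAt f p) :
    ‖f‖ = v p * ‖f p‖ := by
  refine le_antisymm (norm_le (mul_nonneg (v.pos p).le (norm_nonneg _)) fun z => ?_) ((le_norm f) p)
  rcases eq_or_ne z p with rfl | hz
  · exact le_rfl
  · exact (h z hz).le

/-- The norm is smooth at a peaking function, with derivative a multiple of the evaluation at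
the peak point. -/
theorem PeaksAt.apply_eq_zero {f : LittleWeightedH v} {p : U} (h : PeaksAt f p) (hf : 0 < ‖f‖)
    (L : LittleWeightedH v →ₗ[ℂ] ℂ) (hL : ∀ g, ‖L g‖ ≤ ‖g‖) (hLf : ‖L f‖ = ‖f‖)
    {g : LittleWeightedH v} (hg : g p = 0) : L g = 0 := by
  refine norm_le_zero_iff.mp (le_of_forall_pos_le_add fun ε hε => ?_)
  rw [zero_add]
  have hcl : IsClosed {z : U | ε ≤ v z * ‖g z‖} :=
    isClosed_le continuous_const (continuous_weight_mul g)
  obtain ⟨m, hm, hb⟩ := exists_bound_lt_of_isClosed hf hcl fun z hz => by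
    rw [h.norm_eq]
    refine h z ?_
    rintro rfl
    rw [Set.mem_ofPred_eq, hg, norm_zero, mul_zero] at hz
    linarith
  obtain ⟨s, hs, hsg⟩ : ∃ s : ℝ, 0 < s ∧ s * ‖g‖ ≤ ‖f‖ - m := by
    have hg1 : 0 < ‖g‖ + 1 := by positivity
    refine ⟨(‖f‖ - m) / (‖g‖ + 1), div_pos (sub_pos.mpr hm) hg1, ?_⟩
    rw [div_mul_eq_mul_div, div_le_iff₀ hg1]
    nlinarith [sub_pos.mpr hm]
  by_cases hLg : L g = 0
  · rw [hLg, norm_zero]; exact hε.le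
  have hLg' : ‖L g‖ ≠ 0 := norm_ne_zero_iff.mpr hLg
  have hLf0 : L f ≠ 0 := norm_ne_zero_iff.mp (hLf ▸ hf.ne')
  set μ : ℂ := (L f / ‖L f‖) * (‖L g‖ / L g) with hμ
  have hμ1 : ‖μ‖ = 1 := by
    rw [hμ, norm_mul, norm_div, norm_div, Complex.norm_real, Complex.norm_real, norm_norm, norm_norm,
      div_self hLg', div_self (norm_ne_zero_iff.mpr hLf0), one_mul]
  have h1 : ‖f + ((s : ℂ) * μ) • g‖ ≤ ‖f‖ + s * ε := by
    refine norm_le (by positivity) fun z => ?_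
    have h2 : v z * ‖f z + (s * μ) * g z‖ ≤ v z * ‖f z‖ + s * (v z * ‖g z‖) := by
      have h3 := mul_le_mul_of_nonneg_left (norm_add_le (f z) ((s * μ) * g z)) (v.pos z).le
      rw [norm_mul, norm_mul, hμ1, Complex.norm_of_nonneg hs.le] at h3
      linarith
    rw [add_apply, smul_apply]
    refine h2.trans ?_
    rcases lt_or_ge (v z * ‖g z‖) ε with hz | hz
    · exact add_le_add (le_norm f z) (mul_le_mul_of_nonneg_left hz.le hs.le)
    · have h4 := hb z hz
      have h5 := mul_le_mul_of_nonneg_left ((le_norm g) z) hs.le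
      nlinarith [mul_pos hs hε]
  have h6 : ‖L (f + ((s : ℂ) * μ) • g)‖ = ‖f‖ + s * ‖L g‖ := by
    have h7 : L (f + ((s : ℂ) * μ) • g) = (L f / ‖L f‖) * ((‖f‖ + s * ‖L g‖ : ℝ) : ℂ) := by
      rw [map_add, map_smul, smul_eq_mul, hμ, ← hLf]
      have h8 : ((‖L f‖ : ℝ) : ℂ) ≠ 0 := by exact_mod_cast norm_ne_zero_iff.mpr hLf0
      push_cast
      field_simp
    rw [h7, norm_mul, norm_div, Complex.norm_real, norm_norm, div_self (norm_ne_zero_iff.mpr hLf0),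
      one_mul, Complex.norm_of_nonneg (by positivity)]
  have h9 := (h6 ▸ hL (f + ((s : ℂ) * μ) • g)).trans h1
  exact le_of_mul_le_mul_left (by linarith) hs

theorem PeaksAt.apply_mul_eq {f : LittleWeightedH v} {p : U} (h : PeaksAt f p) (hf : 0 < ‖f‖)
    (L : LittleWeightedH v →ₗ[ℂ] ℂ) (hL : ∀ g, ‖L g‖ ≤ ‖g‖) (hLf : ‖L f‖ = ‖f‖)
    (g : LittleWeightedH v) : L g * f p = g p * L f := by
  have h1 := h.apply_eq_zero hf L hL hLf (g := f p • g - g p • f) (by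
    rw [sub_apply, smul_apply, smul_apply]; ring)
  rw [map_sub, map_smul, map_smul, smul_eq_mul, smul_eq_mul, sub_eq_zero] at h1
  rw [mul_comm, h1]

/-- The evaluation at `z`, multiplied by the weight. -/
def weightedEval (v : Weight U) (z : U) : LittleWeightedH v →ₗ[ℂ] ℂ where
  toFun f := (v z : ℂ) * f z
  map_add' f g := by rw [add_apply]; ring
  map_smul' c f := by rw [smul_apply, RingHom.id_apply, smul_eq_mul]; ring

theorem norm_weightedEval (z : U) (f : LittleWeightedH v) :
    ‖weightedEval v z f‖ = v z * ‖f z‖ := by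
  change ‖(v z : ℂ) * f z‖ = _
  rw [norm_mul, Complex.norm_of_nonneg (v.pos z).le]

/-- An isometry between little weighted spaces carries, at suitable points, evaluations to
evaluations. -/
theorem PeaksAt.exists_eval {w : Weight U} (T : LittleWeightedH v →ₗᵢ[ℂ] LittleWeightedH w)
    {f e : LittleWeightedH v} (he : ∀ z, e z = 1) {p : U} (h : PeaksAt f p) (hf : 0 < ‖f‖) :
    ∃ q : U, w q * ‖T e q‖ = v p ∧ ∀ g, T g q = T e q * g p := by
  obtain ⟨q, hq⟩ := exists_norm_eq (f := T f) (by rwa [T.norm_map])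
  have key : ∀ g, T g q * f p = g p * T f q := fun g => by
    have h1 := h.apply_mul_eq hf ((weightedEval w q).comp T.toLinearMap)
      (fun g => by
        rw [LinearMap.comp_apply, norm_weightedEval]
        exact (le_norm (T g) q).trans_eq (T.norm_map g))
      (by
        rw [LinearMap.comp_apply, norm_weightedEval]
        exact hq.trans (T.norm_map f)) g
    change (w q : ℂ) * T g q * f p = g p * ((w q : ℂ) * T f q) at h1
    have hw : (w q : ℂ) ≠ 0 := by exact_mod_cast (w.pos q).ne'
    exact mul_left_cancel₀ hw (by linear_combination h1)
  have hfp : f p ≠ 0 := by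
    intro h0
    rw [h.norm_eq, h0, norm_zero, mul_zero] at hf
    exact lt_irrefl _ hf
  have h2 := key e
  rw [he, one_mul] at h2
  refine ⟨q, ?_, fun g => ?_⟩
  · have h3 : w q * ‖T e q‖ * ‖f p‖ = v p * ‖f p‖ := by
      rw [mul_assoc, ← norm_mul, h2, hq, T.norm_map, h.norm_eq]
    exact mul_right_cancel₀ (norm_ne_zero_iff.mpr hfp) h3
  · refine mul_right_cancel₀ hfp ?_
    rw [key, ← h2]; ring

/-- The restriction of an entire function, when the weight tends to zero at the boundary. -/
def ofEntire {v : Weight unitDisc} (hv : ∀ z, v z ≤ 2 * (1 - ‖(z : ℂ)‖)) (F : ℂ → ℂ)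
    (hF : Differentiable ℂ F) : LittleWeightedH v :=
  have hb : ∃ C : ℝ, 0 < C ∧ ∀ z : unitDisc, ‖F z‖ ≤ C := by
    obtain ⟨C, hC⟩ := (isCompact_closedBall (0 : ℂ) 1).exists_bound_of_continuousOn
      hF.continuous.continuousOn
    exact ⟨max C 1, by positivity, fun z =>
      (hC z (Metric.ball_subset_closedBall z.2)).trans (le_max_left _ _)⟩
  ⟨⟨fun z => F z, IsHolomorphic.congr_ext hF.differentiableOn fun _ => rfl, by
    obtain ⟨B, hB⟩ := v.bounded_toFun
    obtain ⟨C, hC, hFC⟩ := hb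
    refine ⟨B * C, ?_⟩
    rintro _ ⟨z, rfl⟩
    exact mul_le_mul (hB ⟨z, rfl⟩) (hFC z) (norm_nonneg _) ((v.pos z).le.trans (hB ⟨z, rfl⟩))⟩, by
    intro ε hε
    obtain ⟨C, hC, hFC⟩ := hb
    refine ⟨{z | ‖(z : ℂ)‖ ≤ 1 - ε / (2 * C)}, ?_, fun z hz => ?_⟩
    · rw [Subtype.isCompact_iff]
      convert isCompact_closedBall (0 : ℂ) (1 - ε / (2 * C)) using 1
      ext z
      simp only [Set.mem_image, Set.mem_ofPred_eq, Subtype.exists, Metric.mem_closedBall,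
        dist_zero_right, exists_and_left, exists_prop, exists_eq_right_right, Metric.mem_ball]
      have h1 : 0 < ε / (2 * C) := by positivity
      constructor
      · exact fun h => h.1
      · exact fun h => ⟨h, by linarith⟩
    · rw [Set.mem_ofPred_eq, not_le] at hz
      have h2 : v z < ε / C := by
        refine (hv z).trans_lt ?_
        have : ε / (2 * C) = ε / C / 2 := by field_simp
        linarith
      calc v z * ‖F z‖ ≤ v z * C := mul_le_mul_of_nonneg_left (hFC z) (v.pos z).le
        _ < ε := (lt_div_iff₀ hC).mp h2⟩

theorem ofEntire_apply {v : Weight unitDisc} (hv : ∀ z, v z ≤ 2 * (1 - ‖(z : ℂ)‖)) (F : ℂ → ℂ)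
    (hF : Differentiable ℂ F) (z : unitDisc) : ofEntire hv F hF z = F z := rfl

end LittleWeightedH

theorem discWeight_apply (z : unitDisc) : discWeight z = 1 - ‖(z : ℂ)‖ := rfl

theorem discWeightSq_apply (z : unitDisc) : discWeightSq z = 1 - ‖(z : ℂ)‖ ^ 2 := rfl

theorem discWeight_le (z : unitDisc) : discWeight z ≤ 2 * (1 - ‖(z : ℂ)‖) := by
  rw [discWeight_apply]
  linarith [norm_lt_one_of_disc z]

theorem discWeightSq_le (z : unitDisc) : discWeightSq z ≤ 2 * (1 - ‖(z : ℂ)‖) := by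
  rw [discWeightSq_apply]
  nlinarith [norm_lt_one_of_disc z, norm_nonneg (z : ℂ)]

theorem coe_discSq (z : unitDisc) : (discSq z : ℂ) = (z : ℂ) ^ 2 := rfl

theorem discWeight_discSq (z : unitDisc) : discWeight (discSq z) = discWeightSq z := by
  rw [discWeight_apply, discWeightSq_apply, coe_discSq, norm_pow]

theorem one_sub_mul_exp_lt {r s : ℝ} (hs : s < 1) (h : r ≠ s) :
    (1 - r) * Real.exp (r / (1 - s)) < (1 - s) * Real.exp (s / (1 - s)) := by
  have hs' : 0 < 1 - s := sub_pos.mpr hs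
  have h1 : (s - r) / (1 - s) + 1 < Real.exp ((s - r) / (1 - s)) :=
    Real.add_one_lt_exp (div_ne_zero (sub_ne_zero.mpr h.symm) hs'.ne')
  have h2 : s / (1 - s) = r / (1 - s) + (s - r) / (1 - s) := by ring
  rw [h2, Real.exp_add]
  have h3 : (s - r) / (1 - s) + 1 = (1 - r) / (1 - s) := by field_simp; ring
  rw [h3, div_lt_iff₀ hs'] at h1
  nlinarith [Real.exp_pos (r / (1 - s))]

/-- Each point of the disc is a peak point for the weight `1 - |z|`. -/
theorem exists_peaksAt_discWeight (p : unitDisc) :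
    ∃ f : LittleWeightedH discWeight, LittleWeightedH.PeaksAt f p ∧ 0 < ‖f‖ := by
  obtain ⟨u, hu, hup⟩ : ∃ u : ℂ, ‖u‖ = 1 ∧ (p : ℂ) = ‖(p : ℂ)‖ * u := by
    rcases eq_or_ne (p : ℂ) 0 with h | h
    · exact ⟨1, norm_one, by simp [h]⟩
    · have h' : ((‖(p : ℂ)‖ : ℝ) : ℂ) ≠ 0 := by exact_mod_cast norm_ne_zero_iff.mpr h
      exact ⟨p / ‖(p : ℂ)‖, by simp [norm_ne_zero_iff.mpr h], by field_simp⟩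
  set s := ‖(p : ℂ)‖ with hs
  have hs1 : s < 1 := norm_lt_one_of_disc p
  have huu : conj u * u = 1 := by
    rw [mul_comm, Complex.mul_conj, Complex.normSq_eq_norm_sq, hu]; simp
  let f := LittleWeightedH.ofEntire discWeight_le
    (fun z => Complex.exp (((1 - s)⁻¹ : ℝ) * (conj u * z))) (by fun_prop)
  have hf : ∀ z : unitDisc, ‖f z‖ = Real.exp ((conj u * z).re / (1 - s)) := fun z => by
    change ‖Complex.exp (((1 - s)⁻¹ : ℝ) * (conj u * z))‖ = _
    rw [Complex.norm_exp, Complex.re_ofReal_mul, div_eq_inv_mul]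
  have hre : ∀ z : unitDisc, (conj u * z).re ≤ ‖(z : ℂ)‖ := fun z => by
    refine (Complex.re_le_norm _).trans_eq ?_
    rw [norm_mul, RCLike.norm_conj, hu, one_mul]
  have hpeq : (conj u * (p : ℂ)).re = s := by
    rw [hup, mul_left_comm, huu, mul_one, Complex.ofReal_re]
  have hpk : LittleWeightedH.PeaksAt f p := by
    intro z hz
    rw [hf, hf, hpeq, discWeight_apply, discWeight_apply, ← hs]
    have hz1 := norm_lt_one_of_disc z
    by_cases hzs : ‖(z : ℂ)‖ = s
    · rw [hzs]
      refine mul_lt_mul_of_pos_left (Real.exp_lt_exp.mpr ?_) (sub_pos.mpr hs1)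
      refine div_lt_div_of_pos_right (lt_of_le_of_ne (hzs ▸ hre z) fun heq => hz ?_)
        (sub_pos.mpr hs1)
      have h1 : conj u * z = ((s : ℝ) : ℂ) := by
        have h2 : ‖conj u * (z : ℂ)‖ = (conj u * (z : ℂ)).re := by
          rw [norm_mul, RCLike.norm_conj, hu, one_mul, heq, hzs]
        have h3 := Complex.re_eq_norm.mp h2.symm
        rw [Complex.eq_coe_norm_of_nonneg h3, h2, heq]
      refine Subtype.ext ?_
      rw [hup, ← h1, mul_right_comm, huu, one_mul]
    · refine lt_of_le_of_lt ?_ (one_sub_mul_exp_lt hs1 hzs)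
      refine mul_le_mul_of_nonneg_left (Real.exp_le_exp.mpr ?_) (sub_pos.mpr hz1).le
      exact div_le_div_of_nonneg_right (hre z) (sub_pos.mpr hs1).le
  refine ⟨f, hpk, ?_⟩
  rw [hpk.norm_eq, hf]
  exact mul_pos (discWeight.pos p) (Real.exp_pos _)

theorem discSq_surjective : Function.Surjective discSq := by
  intro z
  obtain ⟨u, hu⟩ := IsAlgClosed.exists_pow_nat_eq (z : ℂ) two_pos
  refine ⟨⟨u, ?_⟩, Subtype.ext hu⟩
  rw [mem_ball_zero_iff]
  have h1 : ‖u‖ ^ 2 < 1 := by rw [← norm_pow, hu]; exact norm_lt_one_of_disc z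
  exact (sq_lt_one_iff₀ (norm_nonneg u)).mp h1

theorem isCompact_preimage_discSq {K : Set unitDisc} (hK : IsCompact K) :
    IsCompact (discSq ⁻¹' K) := by
  rw [Subtype.isCompact_iff] at hK ⊢
  have h1 : (Subtype.val '' (discSq ⁻¹' K) : Set ℂ) =
      Metric.closedBall 0 1 ∩ (fun z : ℂ => z ^ 2) ⁻¹' (Subtype.val '' K) := by
    ext z
    constructor
    · rintro ⟨x, hx, rfl⟩
      exact ⟨Metric.ball_subset_closedBall x.2, discSq x, hx, rfl⟩
    · rintro ⟨-, y, hy, hyz⟩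
      replace hyz : (y : ℂ) = z ^ 2 := hyz
      have hz : z ∈ unitDisc := by
        rw [mem_ball_zero_iff]
        have h1 : ‖z‖ ^ 2 < 1 := by rw [← norm_pow, ← hyz]; exact norm_lt_one_of_disc y
        exact (sq_lt_one_iff₀ (norm_nonneg z)).mp h1
      refine ⟨⟨z, hz⟩, ?_, rfl⟩
      rw [Set.mem_preimage, show discSq ⟨z, hz⟩ = y from Subtype.ext hyz.symm]
      exact hy
  rw [h1]
  exact (isCompact_closedBall _ _).inter_right (hK.isClosed.preimage (continuous_pow 2))

/-- The composition with the squaring map, as a linear map. -/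
def compSq : LittleWeightedH discWeight →ₗ[ℂ] LittleWeightedH discWeightSq where
  toFun f := ⟨⟨fun z => f (discSq z), by
      refine IsHolomorphic.congr_ext (g := fun z => extendZero f.1.1 (z ^ 2)) ?_ fun z => ?_
      · exact DifferentiableOn.comp (t := unitDisc) (LittleWeightedH.isHolomorphic f) (by fun_prop)
          fun z hz => (discSq ⟨z, hz⟩).2
      · exact (extendZero_apply f.1.1 (discSq z)).symm, by
      refine ⟨‖f‖, ?_⟩
      rintro _ ⟨z, rfl⟩
      dsimp only
      rw [← discWeight_discSq]
      exact (LittleWeightedH.le_norm f) _⟩, by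
    intro ε hε
    obtain ⟨K, hK, h⟩ := f.2 ε hε
    refine ⟨_, isCompact_preimage_discSq hK, fun z hz => ?_⟩
    rw [← discWeight_discSq]
    exact h _ hz⟩
  map_add' _ _ := rfl
  map_smul' _ _ := rfl

theorem compSq_apply (f : LittleWeightedH discWeight) (z : unitDisc) :
    compSq f z = f (discSq z) := rfl

theorem norm_compSq (f : LittleWeightedH discWeight) : ‖compSq f‖ = ‖f‖ := by
  rw [LittleWeightedH.norm_def, LittleWeightedH.norm_def,
    ← discSq_surjective.iSup_comp (g := fun z => discWeight z * ‖f z‖)]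
  exact iSup_congr fun z => by rw [discWeight_discSq, compSq_apply]

theorem compSq_not_surjective : ¬ Function.Surjective compSq := by
  intro h
  obtain ⟨f, hf⟩ := h (LittleWeightedH.ofEntire discWeightSq_le (fun z => z) differentiable_id)
  have h2 : (1 / 2 : ℂ) ∈ unitDisc := by
    rw [mem_ball_zero_iff]; norm_num
  have h3 : (-(1 / 2) : ℂ) ∈ unitDisc := by
    rw [mem_ball_zero_iff, norm_neg]; norm_num
  have h4 : discSq ⟨1 / 2, h2⟩ = discSq ⟨-(1 / 2), h3⟩ := Subtype.ext (by
    rw [coe_discSq, coe_discSq]; norm_num)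
  have h5 : compSq f ⟨1 / 2, h2⟩ = compSq f ⟨-(1 / 2), h3⟩ := by
    rw [compSq_apply, compSq_apply, h4]
  rw [hf, LittleWeightedH.ofEntire_apply, LittleWeightedH.ofEntire_apply] at h5
  norm_num at h5

/-! ### Holomorphic functions that cover an open set from a relatively closed set -/

theorem exists_interior_nonempty_of_countable_cover {X : Type*} [TopologicalSpace X] [BaireSpace X]
    {𝒮 : Set (Set X)} (h𝒮 : 𝒮.Countable) (hcl : ∀ A ∈ 𝒮, IsClosed A) {V : Set X} (hV : IsOpen V)
    (hne : V.Nonempty) (hcov : V ⊆ ⋃₀ 𝒮) : ∃ A ∈ 𝒮, (interior A).Nonempty := by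
  by_contra! h
  have hd : Dense (⋂ A ∈ 𝒮, Aᶜ) :=
    dense_biInter_of_isOpen (fun A hA => (hcl A hA).isOpen_compl) h𝒮
      fun A hA => interior_eq_empty_iff_dense_compl.mp (h A hA)
  obtain ⟨x, hxV, hx⟩ := hd.inter_open_nonempty V hV hne
  obtain ⟨A, hA, hxA⟩ := hcov hxV
  exact Set.mem_iInter₂.mp hx A hA hxA

/-- The image of a set of critical points has empty interior. -/
theorem interior_image_eq_empty_of_deriv_eq_zero {φ : ℂ → ℂ} {s : Set ℂ}
    (hφ : ∀ z ∈ s, HasDerivAt φ 0 z) : interior (φ '' s) = ∅ := by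
  refine MeasureTheory.Measure.interior_eq_empty_of_null (μ := MeasureTheory.volume) ?_
  refine MeasureTheory.addHaar_image_eq_zero_of_det_fderivWithin_eq_zero MeasureTheory.volume
    (f' := fun _ => 0) (fun z hz => ?_) fun z _ => ?_
  · have h := (hφ z hz).hasFDerivAt.restrictScalars ℝ
    exact (h.congr_fderiv (g' := (0 : ℂ →L[ℝ] ℂ)) (by ext <;> simp)).hasFDerivWithinAt
  · simp [ContinuousLinearMap.det]

theorem exists_mem_interior_of_subset_image {φ : ℂ → ℂ} {Ω V E : Set ℂ} (hΩ : IsOpen Ω)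
    (hφ : DifferentiableOn ℂ φ Ω) (hE : E ⊆ Ω) (hcl : ∀ z ∈ Ω, z ∈ closure E → z ∈ E)
    (hV : IsOpen V) (hne : V.Nonempty) (hcov : V ⊆ φ '' E) :
    ∃ z ∈ interior E, deriv φ z ≠ 0 := by
  have hd : DifferentiableOn ℂ (deriv φ) Ω := hφ.deriv hΩ
  have hlocal : ∀ z ∈ {z ∈ Ω | deriv φ z ≠ 0}, ∃ O K : Set ℂ, IsOpen O ∧ IsCompact K ∧ K ∈ 𝓝 z ∧
      K ⊆ O ∧ O ⊆ {z ∈ Ω | deriv φ z ≠ 0} ∧ Set.InjOn φ O := by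
    rintro z ⟨hz, hz'⟩
    have h1 : HasStrictDerivAt φ (deriv φ z) z :=
      ((hφ.analyticOnNhd hΩ) z hz).hasStrictDerivAt
    have h2 : ∀ᶠ x in 𝓝 z, deriv φ x ≠ 0 :=
      (hd.continuousOn.continuousAt (hΩ.mem_nhds hz)).eventually_ne hz'
    obtain ⟨O, hOsub, hO, hzO⟩ := mem_nhds_iff.mp
      ((hΩ.eventually_mem hz).and (h2.and (h1.eventually_left_inverse hz')))
    obtain ⟨K, hK, hzK, hKO⟩ := exists_compact_subset hO hzO
    refine ⟨O, K, hO, hK, mem_interior_iff_mem_nhds.mp hzK, hKO,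
      fun x hx => ⟨(hOsub hx).1, (hOsub hx).2.1⟩, fun x hx y hy hxy => ?_⟩
    rw [← (hOsub hx).2.2, hxy, (hOsub hy).2.2]
  choose! O K hO hK hKn hKO hOΩ hinj using hlocal
  obtain ⟨t, htΩ, ht, hcovt⟩ := TopologicalSpace.countable_cover_nhdsWithin
    (f := K) fun z hz => mem_nhdsWithin_of_mem_nhds (hKn z hz)
  obtain ⟨F, hFcl, hFΩ, hFU, -⟩ := hΩ.exists_iUnion_isClosed
  have hEK : ∀ L : Set ℂ, IsCompact L → L ⊆ Ω → IsCompact (E ∩ L) := fun L hL hLΩ => by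
    have : E ∩ L = closure E ∩ L := Set.Subset.antisymm
      (Set.inter_subset_inter_left _ subset_closure) fun x hx => ⟨hcl x (hLΩ hx.2) hx.1, hx.2⟩
    rw [this]
    exact hL.inter_left isClosed_closure
  let A : ℕ × ℕ → Set ℂ := fun n => (F n.1 ∩ deriv φ ⁻¹' {0}) ∩ Metric.closedBall 0 n.2
  have hAc : ∀ n, IsCompact (A n) := fun n =>
    (isCompact_closedBall _ _).inter_left
      ((hd.continuousOn.mono (hFΩ n.1)).preimage_isClosed_of_isClosed (hFcl n.1) isClosed_singleton)
  have hAΩ : ∀ n, A n ⊆ Ω := fun n z hz => hFΩ n.1 hz.1.1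
  obtain ⟨B, hB, hBne⟩ := exists_interior_nonempty_of_countable_cover
    (𝒮 := Set.range (fun n => φ '' A n) ∪ (fun z => φ '' (E ∩ K z)) '' t)
    ((Set.countable_range _).union (ht.image _))
    (by
      rintro B (⟨n, rfl⟩ | ⟨z, hz, rfl⟩)
      · exact ((hAc n).image_of_continuousOn (hφ.continuousOn.mono (hAΩ n))).isClosed
      · exact ((hEK (K z) (hK z (htΩ hz)) fun x hx =>
          (hOΩ z (htΩ hz) (hKO z (htΩ hz) hx)).1).image_of_continuousOn
            (hφ.continuousOn.mono fun x hx => hE hx.1)).isClosed)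
    hV hne (by
      intro p hp
      obtain ⟨q, hq, rfl⟩ := hcov hp
      by_cases hq' : deriv φ q = 0
      · obtain ⟨n, hn⟩ := Set.mem_iUnion.mp (hFU.symm ▸ hE hq)
        obtain ⟨m, hm⟩ := exists_nat_ge ‖q‖
        exact ⟨_, Or.inl ⟨(n, m), rfl⟩, q, ⟨⟨hn, hq'⟩, mem_closedBall_zero_iff.mpr hm⟩, rfl⟩
      · obtain ⟨z, hz, hqz⟩ := Set.mem_iUnion₂.mp (hcovt ⟨hE hq, hq'⟩)
        exact ⟨_, Or.inr ⟨z, hz, rfl⟩, q, ⟨hq, hqz⟩, rfl⟩)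
  rcases hB with ⟨n, rfl⟩ | ⟨z, hz, rfl⟩
  · rw [interior_image_eq_empty_of_deriv_eq_zero fun z hz => ?_] at hBne
    · exact absurd hBne Set.not_nonempty_empty
    · have h1 := (hφ.differentiableAt (hΩ.mem_nhds (hAΩ n hz))).hasDerivAt
      rwa [show deriv φ z = 0 from hz.1.2] at h1
  · obtain ⟨p, hp⟩ := hBne
    obtain ⟨x, hx, rfl⟩ := interior_subset hp
    have hz' := htΩ hz
    have hxO := hKO z hz' hx.2
    have hxΩ := hOΩ z hz' hxO
    refine ⟨x, ?_, hxΩ.2⟩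
    rw [mem_interior_iff_mem_nhds] at hp ⊢
    filter_upwards [(hO z hz').mem_nhds hxO,
      (hφ.continuousOn.continuousAt (hΩ.mem_nhds hxΩ.1)).preimage_mem_nhds hp] with y hyO hy
    obtain ⟨e, he, hey⟩ := hy
    rw [← hinj z hz' (hKO z hz' he.2) hyO hey]
    exact he.1

/-! ### Polarization -/

theorem eqOn_zero_of_real_eq_zero {f : ℂ → ℂ} {R : ℝ}
    (hf : DifferentiableOn ℂ f (Metric.ball 0 R)) (h : ∀ x : ℝ, |x| < R → f x = 0) :
    ∀ z ∈ Metric.ball (0 : ℂ) R, f z = 0 := by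
  intro z hz
  have hR : 0 < R := Metric.pos_of_mem_ball hz
  refine AnalyticOnNhd.eqOn_of_preconnected_of_frequently_eq (g := 0)
    (hf.analyticOnNhd Metric.isOpen_ball) (fun _ _ => analyticAt_const)
    (convex_ball 0 R).isPreconnected (Metric.mem_ball_self hR) ?_ hz
  have h1 : ∃ᶠ x : ℝ in 𝓝[≠] 0, |x| < R := by
    refine Eventually.frequently (Filter.Eventually.filter_mono nhdsWithin_le_nhds ?_)
    filter_upwards [Metric.ball_mem_nhds (0 : ℝ) hR] with x hx
    simpa using hx
  have h2 : Tendsto (fun x : ℝ => (x : ℂ)) (𝓝[≠] 0) (𝓝[≠] 0) := by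
    refine tendsto_nhdsWithin_iff.mpr ⟨?_, ?_⟩
    · exact (Complex.continuous_ofReal.tendsto' 0 0 Complex.ofReal_zero).mono_left
        nhdsWithin_le_nhds
    · filter_upwards [self_mem_nhdsWithin] with x hx
      simpa using hx
  exact h2.frequently (h1.mono fun x hx => h x hx)

/-- A holomorphic function of two variables that vanishes on the totally real set `w = conj z`
vanishes nearby. -/
theorem eq_zero_of_conj_eq_zero {G : ℂ × ℂ → ℂ} {q : ℂ} {R : ℝ}
    (hG : ∀ z ∈ Metric.ball q R, ∀ w ∈ Metric.ball (conj q) R, DifferentiableAt ℂ G (z, w))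
    (h : ∀ z ∈ Metric.ball q R, G (z, conj z) = 0) :
    ∀ z ∈ Metric.ball q (R / 2), ∀ w ∈ Metric.ball (conj q) (R / 2), G (z, w) = 0 := by
  have hI : ∀ y : ℂ, ‖Complex.I * y‖ = ‖y‖ := fun y => by
    rw [norm_mul, Complex.norm_I, one_mul]
  have hmem : ∀ x ∈ Metric.ball (0 : ℂ) (R / 2), ∀ y ∈ Metric.ball (0 : ℂ) (R / 2),
      q + x + Complex.I * y ∈ Metric.ball q R ∧ conj q + x - Complex.I * y ∈ Metric.ball (conj q) R := by
    intro x hx y hy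
    rw [mem_ball_zero_iff] at hx hy
    rw [mem_ball_iff_norm, mem_ball_iff_norm]
    constructor
    · calc ‖q + x + Complex.I * y - q‖ = ‖x + Complex.I * y‖ := by ring_nf
        _ ≤ ‖x‖ + ‖Complex.I * y‖ := norm_add_le _ _
        _ < R := by rw [hI]; linarith
    · calc ‖conj q + x - Complex.I * y - conj q‖ = ‖x - Complex.I * y‖ := by ring_nf
        _ ≤ ‖x‖ + ‖Complex.I * y‖ := norm_sub_le _ _
        _ < R := by rw [hI]; linarith
  have hGd : ∀ x ∈ Metric.ball (0 : ℂ) (R / 2), ∀ y ∈ Metric.ball (0 : ℂ) (R / 2),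
      DifferentiableAt ℂ G (q + x + Complex.I * y, conj q + x - Complex.I * y) :=
    fun x hx y hy => hG _ (hmem x hx y hy).1 _ (hmem x hx y hy).2
  have hr : ∀ x : ℝ, |x| < R / 2 → (x : ℂ) ∈ Metric.ball (0 : ℂ) (R / 2) := fun x hx => by
    rwa [mem_ball_zero_iff, Complex.norm_real, Real.norm_eq_abs]
  have h1 : ∀ y : ℝ, |y| < R / 2 → ∀ x ∈ Metric.ball (0 : ℂ) (R / 2),
      G (q + x + Complex.I * y, conj q + x - Complex.I * y) = 0 := fun y hy =>
    eqOn_zero_of_real_eq_zero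
      (fun x hx => ((hGd x hx y (hr y hy)).comp x (f := fun x : ℂ =>
        (q + x + Complex.I * y, conj q + x - Complex.I * y)) (by fun_prop)).differentiableWithinAt)
      fun x hx => by
        have := h _ (hmem x (hr x hx) y (hr y hy)).1
        simpa [sub_eq_add_neg] using this
  have h2 : ∀ x ∈ Metric.ball (0 : ℂ) (R / 2), ∀ y ∈ Metric.ball (0 : ℂ) (R / 2),
      G (q + x + Complex.I * y, conj q + x - Complex.I * y) = 0 := fun x hx =>
    eqOn_zero_of_real_eq_zero
      (fun y hy => ((hGd x hx y hy).comp y (f := fun y : ℂ =>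
        (q + x + Complex.I * y, conj q + x - Complex.I * y)) (by fun_prop)).differentiableWithinAt)
      fun y hy => h1 y hy x hx
  intro z hz w hw
  rw [mem_ball_iff_norm] at hz hw
  have hx : ((z - q) + (w - conj q)) / 2 ∈ Metric.ball (0 : ℂ) (R / 2) := by
    rw [mem_ball_zero_iff, norm_div, Complex.norm_two]
    linarith [norm_add_le (z - q) (w - conj q)]
  have hy : -Complex.I * ((z - q) - (w - conj q)) / 2 ∈ Metric.ball (0 : ℂ) (R / 2) := by
    rw [mem_ball_zero_iff, norm_div, Complex.norm_two, norm_mul, norm_neg, Complex.norm_I, one_mul]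
    linarith [norm_sub_le (z - q) (w - conj q)]
  have h3 := h2 _ hx _ hy
  convert h3 using 3
  · linear_combination (1 / 2 : ℂ) * ((z - q) - (w - conj q)) * Complex.I_mul_I
  · linear_combination (-1 / 2 : ℂ) * ((z - q) - (w - conj q)) * Complex.I_mul_I

/-! ### The local form of a pair with `|h| (1 - |z|^2) = 1 - |φ|` -/

theorem AnalyticAt.exists_sq_eq {h : ℂ → ℂ} {q : ℂ} (hh : AnalyticAt ℂ h q) (h0 : h q ≠ 0) :
    ∃ g : ℂ → ℂ, AnalyticAt ℂ g q ∧ ∀ᶠ z in 𝓝 q, g z ^ 2 = h z := by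
  obtain ⟨s, hs⟩ := IsAlgClosed.exists_pow_nat_eq (h q) two_pos
  have hd : AnalyticAt ℂ (fun z => h z / h q) q := hh.div analyticAt_const h0
  refine ⟨fun z => s * Complex.exp (Complex.log (h z / h q) / 2), ?_, ?_⟩
  · have hl : AnalyticAt ℂ (fun z => Complex.log (h z / h q)) q :=
      hd.clog (by rw [div_self h0]; exact Complex.one_mem_slitPlane)
    exact analyticAt_const.mul ((hl.div analyticAt_const two_ne_zero).cexp)
  · filter_upwards [hh.continuousAt.eventually_ne h0] with z hz
    rw [mul_pow, hs, ← Complex.exp_nat_mul]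
    push_cast
    rw [mul_div_cancel₀ _ (two_ne_zero : (2 : ℂ) ≠ 0), Complex.exp_log (div_ne_zero hz h0),
      mul_div_cancel₀ _ h0]

theorem exists_polarization {g ψ : ℂ → ℂ} {q : ℂ} (hg : AnalyticAt ℂ g q) (hψ : AnalyticAt ℂ ψ q)
    (h : ∀ᶠ z in 𝓝 q, ‖g z‖ ^ 2 * (1 - ‖z‖ ^ 2) = 1 - ‖ψ z‖ ^ 2) :
    ∃ R > 0, ∀ z ∈ Metric.ball q R, ∀ w ∈ Metric.ball q R,
      g z * conj (g w) * (1 - z * conj w) = 1 - ψ z * conj (ψ w) := by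
  obtain ⟨R, hR, hb⟩ := Metric.eventually_nhds_iff_ball.mp
    (hg.eventually_analyticAt.and (hψ.eventually_analyticAt.and h))
  refine ⟨R / 2, half_pos hR, fun z hz w hw => ?_⟩
  have hconj : ∀ w ∈ Metric.ball (conj q) R, conj w ∈ Metric.ball q R := fun w hw => by
    rw [mem_ball_iff_norm] at hw ⊢
    rwa [← RCLike.norm_conj, map_sub, Complex.conj_conj]
  have hc : ∀ f : ℂ → ℂ, (∀ z ∈ Metric.ball q R, AnalyticAt ℂ f z) →
      ∀ w ∈ Metric.ball (conj q) R, DifferentiableAt ℂ (fun w => conj (f (conj w))) w :=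
    fun f hf w hw => by
      have := (hf _ (hconj w hw)).differentiableAt.conj_conj
      rwa [Complex.conj_conj] at this
  let G : ℂ × ℂ → ℂ := fun p =>
    g p.1 * conj (g (conj p.2)) * (1 - p.1 * p.2) - (1 - ψ p.1 * conj (ψ (conj p.2)))
  have hG := eq_zero_of_conj_eq_zero (G := G) (q := q) (R := R)
    (fun z hz w hw => by
      have h1 : DifferentiableAt ℂ (fun p : ℂ × ℂ => g p.1) (z, w) :=
        DifferentiableAt.comp (z, w) (g := g) (hb z hz).1.differentiableAt differentiableAt_fst
      have h2 : DifferentiableAt ℂ (fun p : ℂ × ℂ => ψ p.1) (z, w) :=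
        DifferentiableAt.comp (z, w) (g := ψ) (hb z hz).2.1.differentiableAt differentiableAt_fst
      have h3 : DifferentiableAt ℂ (fun p : ℂ × ℂ => conj (g (conj p.2))) (z, w) :=
        DifferentiableAt.comp (z, w) (g := fun w => conj (g (conj w)))
          (hc g (fun z hz => (hb z hz).1) w hw) differentiableAt_snd
      have h4 : DifferentiableAt ℂ (fun p : ℂ × ℂ => conj (ψ (conj p.2))) (z, w) :=
        DifferentiableAt.comp (z, w) (g := fun w => conj (ψ (conj w)))
          (hc ψ (fun z hz => (hb z hz).2.1) w hw) differentiableAt_snd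
      have h5 : DifferentiableAt ℂ (fun p : ℂ × ℂ => 1 - p.1 * p.2) (z, w) := by fun_prop
      exact ((h1.mul h3).mul h5).sub ((differentiableAt_const 1).sub (h2.mul h4)))
    (fun z hz => by
      have h1 := (hb z hz).2.2
      change g z * conj (g (conj (conj z))) * (1 - z * conj z) -
        (1 - ψ z * conj (ψ (conj (conj z)))) = 0
      rw [Complex.conj_conj, Complex.mul_conj', Complex.mul_conj', Complex.mul_conj', sub_eq_zero]
      exact_mod_cast h1)
  have hw' : conj w ∈ Metric.ball (conj q) (R / 2) := by
    rw [mem_ball_iff_norm] at hw ⊢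
    rwa [← map_sub, RCLike.norm_conj]
  have h1 := hG z hz _ hw'
  change g z * conj (g (conj (conj w))) * (1 - z * conj w) -
    (1 - ψ z * conj (ψ (conj (conj w)))) = 0 at h1
  rwa [Complex.conj_conj, sub_eq_zero] at h1

/-- The coefficients of a Moebius transformation `z ↦ (γ + δ z) / (α + β z)` that preserves the
unit disc. -/
structure IsUnitaryQuadruple (α β γ δ : ℂ) : Prop where
  fst : α * conj α - γ * conj γ = 1
  snd : δ * conj δ - β * conj β = 1
  cross : β * conj α = δ * conj γ

theorem coeff_eq_zero_of_bilinear_eq_zero {A B C D q : ℂ} {R : ℝ} (hR : 0 < R)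
    (h : ∀ z ∈ Metric.ball q R, ∀ w ∈ Metric.ball q R,
      A + B * z + C * conj w + D * z * conj w = 0) : A = 0 ∧ B = 0 ∧ D = 0 := by
  have hq : q ∈ Metric.ball q R := Metric.mem_ball_self hR
  have hR2 : (R / 2 : ℂ) ≠ 0 := by
    have : (R : ℂ) ≠ 0 := by exact_mod_cast hR.ne'
    exact div_ne_zero this two_ne_zero
  have hq2 : q + (R / 2 : ℂ) ∈ Metric.ball q R := by
    rw [mem_ball_iff_norm, add_sub_cancel_left, norm_div, Complex.norm_two, Complex.norm_real,
      Real.norm_of_nonneg hR.le]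
    exact half_lt_self hR
  have h11 := h q hq q hq
  have h12 := h q hq _ hq2
  have h21 := h _ hq2 q hq
  have h22 := h _ hq2 _ hq2
  have hc : conj (q + (R / 2 : ℂ)) = conj q + R / 2 := by
    rw [map_add, map_div₀, Complex.conj_ofReal, map_ofNat]
  rw [hc] at h12 h22
  have hD : D = 0 := by
    have : D * (R / 2 : ℂ) * (R / 2) = 0 := by linear_combination h22 - h21 - h12 + h11
    simpa [hR2] using this
  subst hD
  have hB : B = 0 := by
    have : B * (R / 2 : ℂ) = 0 := by linear_combination h21 - h11
    exact (mul_eq_zero.mp this).resolve_right hR2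
  have hC : C = 0 := by
    have : C * (R / 2 : ℂ) = 0 := by linear_combination h12 - h11
    exact (mul_eq_zero.mp this).resolve_right hR2
  subst hB hC
  exact ⟨by linear_combination h11, rfl, rfl⟩

theorem exists_unitary_of_polarization {g ψ : ℂ → ℂ} {q : ℂ} {R : ℝ} (hR : 0 < R)
    (h : ∀ z ∈ Metric.ball q R, ∀ w ∈ Metric.ball q R,
      g z * conj (g w) * (1 - z * conj w) = 1 - ψ z * conj (ψ w))
    (hne : ∃ w ∈ Metric.ball q R, ψ w ≠ ψ q) :
    ∃ α β γ δ, IsUnitaryQuadruple α β γ δ ∧ ∀ z ∈ Metric.ball q R,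
      g z * (α + β * z) = 1 ∧ ψ z = g z * (γ + δ * z) := by
  obtain ⟨w, hw, hwq⟩ := hne
  have hq : q ∈ Metric.ball q R := Metric.mem_ball_self hR
  have hE : conj (ψ w) - conj (ψ q) ≠ 0 := by
    rw [← map_sub]
    exact (map_ne_zero _).mpr (sub_ne_zero.mpr hwq)
  set E := conj (ψ w) - conj (ψ q) with hEdef
  set γ := (conj (g q) - conj (g w)) / E with hγ
  set δ := (conj w * conj (g w) - conj q * conj (g q)) / E with hδ
  have hγE : γ * E = conj (g q) - conj (g w) := div_mul_cancel₀ _ hE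
  have hδE : δ * E = conj w * conj (g w) - conj q * conj (g q) := div_mul_cancel₀ _ hE
  have h2 : ∀ z ∈ Metric.ball q R, ψ z = g z * (γ + δ * z) := fun z hz => by
    refine mul_right_cancel₀ hE ?_
    linear_combination (-(g z)) * hγE - (g z * z) * hδE + h z hz w hw - h z hz q hq +
      ψ z * hEdef
  set α := conj (g q) + γ * conj (ψ q) with hα
  set β := δ * conj (ψ q) - conj q * conj (g q) with hβ
  have h1 : ∀ z ∈ Metric.ball q R, g z * (α + β * z) = 1 := fun z hz => by
    linear_combination h z hz q hq + g z * hα + g z * z * hβ - conj (ψ q) * h2 z hz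
  have h3 : ∀ z ∈ Metric.ball q R, ∀ w ∈ Metric.ball q R,
      (1 - α * conj α + γ * conj γ) + (δ * conj γ - β * conj α) * z +
        (γ * conj δ - α * conj β) * conj w + (δ * conj δ - β * conj β - 1) * z * conj w = 0 := by
    intro z hz w hw
    have e := h z hz w hw
    rw [h2 z hz, h2 w hw, map_mul, map_add, map_mul] at e
    have e1 := h1 z hz
    have e2 := congrArg conj (h1 w hw)
    rw [map_mul, map_add, map_mul, map_one] at e2
    have e3 : g z * conj (g w) * ((1 - α * conj α + γ * conj γ) + (δ * conj γ - β * conj α) * z +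
        (γ * conj δ - α * conj β) * conj w + (δ * conj δ - β * conj β - 1) * z * conj w) = 0 := by
      linear_combination e - conj (g w) * (conj α + conj β * conj w) * e1 - e2
    refine (mul_eq_zero.mp e3).resolve_left (mul_ne_zero ?_ ?_)
    · exact left_ne_zero_of_mul_eq_one e1
    · exact left_ne_zero_of_mul_eq_one e2
  obtain ⟨hA, hB, hD⟩ := coeff_eq_zero_of_bilinear_eq_zero hR h3
  exact ⟨α, β, γ, δ, ⟨by linear_combination -hA, by linear_combination hD,
    by linear_combination -hB⟩, fun z hz => ⟨h1 z hz, h2 z hz⟩⟩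

theorem exists_unitary_of_norm_eq {h φ : ℂ → ℂ} {q : ℂ} (hh : AnalyticAt ℂ h q)
    (hφ : AnalyticAt ℂ φ q) (h0 : h q ≠ 0) (hφ0 : φ q ≠ 0) (hd : deriv φ q ≠ 0)
    (heq : ∀ᶠ z in 𝓝 q, ‖h z‖ * (1 - ‖z‖ ^ 2) = 1 - ‖φ z‖) :
    ∃ α β γ δ, IsUnitaryQuadruple α β γ δ ∧ ∀ᶠ z in 𝓝 q,
      h z * (α + β * z) ^ 2 = 1 ∧ φ z = h z * (γ + δ * z) ^ 2 := by
  obtain ⟨g, hg, hgh⟩ := hh.exists_sq_eq h0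
  obtain ⟨ψ, hψ, hψφ⟩ := hφ.exists_sq_eq hφ0
  obtain ⟨R, hR, hpol⟩ := exists_polarization hg hψ (by
    filter_upwards [hgh, hψφ, heq] with z h1 h2 h3
    rwa [← norm_pow (g z), ← norm_pow (ψ z), h1, h2])
  have hne : ∃ w ∈ Metric.ball q R, ψ w ≠ ψ q := by
    by_contra! hcon
    refine hd ?_
    have h1 : φ =ᶠ[𝓝 q] fun _ => ψ q ^ 2 := by
      filter_upwards [hψφ, Metric.ball_mem_nhds q hR] with z h2 h3
      rw [← h2, hcon z h3]
    rw [h1.deriv_eq, deriv_const]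
  obtain ⟨α, β, γ, δ, hu, hz⟩ := exists_unitary_of_polarization hR hpol hne
  refine ⟨α, β, γ, δ, hu, ?_⟩
  filter_upwards [hgh, hψφ, Metric.ball_mem_nhds q hR] with z h1 h2 h3
  obtain ⟨h4, h5⟩ := hz z h3
  rw [← h1, ← h2]
  exact ⟨by rw [← mul_pow, h4, one_pow], by rw [h5, mul_pow]⟩

/-! ### Automorphisms of the disc -/

namespace IsUnitaryQuadruple

theorem sq_norm_sub {α β γ δ : ℂ} (h : IsUnitaryQuadruple α β γ δ) (z : ℂ) :
    ‖α + β * z‖ ^ 2 - ‖γ + δ * z‖ ^ 2 = 1 - ‖z‖ ^ 2 := by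
  have h1 := congrArg conj h.cross
  simp only [map_mul, Complex.conj_conj] at h1
  have h2 : (α + β * z) * conj (α + β * z) - (γ + δ * z) * conj (γ + δ * z) = 1 - z * conj z := by
    simp only [map_add, map_mul]
    linear_combination h.fst - z * conj z * h.snd + z * h.cross + conj z * h1
  rw [Complex.mul_conj', Complex.mul_conj', Complex.mul_conj'] at h2
  exact_mod_cast h2

end IsUnitaryQuadruple

/-- The Moebius transformation with the given coefficients. -/
def moebius (α β γ δ z : ℂ) : ℂ := (γ + δ * z) / (α + β * z)

namespace IsUnitaryQuadruple

variable {α β γ δ : ℂ}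

theorem denom_ne_zero (h : IsUnitaryQuadruple α β γ δ) {z : ℂ} (hz : z ∈ unitDisc) :
    α + β * z ≠ 0 := by
  intro h0
  have h1 := h.sq_norm_sub z
  have hz' := mem_ball_zero_iff.mp hz
  rw [h0, norm_zero] at h1
  nlinarith [sq_nonneg ‖γ + δ * z‖, norm_nonneg z]

theorem moebius_mem (h : IsUnitaryQuadruple α β γ δ) {z : ℂ} (hz : z ∈ unitDisc) :
    moebius α β γ δ z ∈ unitDisc := by
  have h1 := h.sq_norm_sub z
  have hz' := mem_ball_zero_iff.mp hz
  have h2 : 0 < ‖α + β * z‖ := norm_pos_iff.mpr (h.denom_ne_zero hz)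
  rw [mem_ball_zero_iff, moebius, norm_div, div_lt_one h2]
  refine lt_of_pow_lt_pow_left₀ 2 h2.le ?_
  nlinarith [norm_nonneg z]

theorem mul_conj_eq (h : IsUnitaryQuadruple α β γ δ) : β * conj β = γ * conj γ := by
  have h1 := congrArg conj h.cross
  simp only [map_mul, Complex.conj_conj] at h1
  linear_combination (-β * conj β) * h.fst + (γ * conj γ) * h.snd + (conj β * α) * h.cross +
    (δ * conj γ) * h1

theorem snd_ne_zero (h : IsUnitaryQuadruple α β γ δ) : δ ≠ 0 := by
  rintro rfl
  have h1 := h.snd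
  rw [zero_mul, Complex.mul_conj'] at h1
  have h2 : (0 : ℝ) - ‖β‖ ^ 2 = 1 := by exact_mod_cast h1
  nlinarith [sq_nonneg ‖β‖]

theorem symm (h : IsUnitaryQuadruple α β γ δ) : IsUnitaryQuadruple δ (-β) (-γ) α where
  fst := by
    rw [map_neg]
    linear_combination h.snd + h.mul_conj_eq
  snd := by
    rw [map_neg]
    linear_combination h.fst - h.mul_conj_eq
  cross := by
    rw [map_neg]
    refine mul_left_cancel₀ h.snd_ne_zero ?_
    linear_combination -α * h.cross - β * h.snd + β * h.fst - β * h.mul_conj_eq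

theorem norm_det (h : IsUnitaryQuadruple α β γ δ) : ‖α * δ - β * γ‖ = 1 := by
  have h1 := congrArg conj h.cross
  simp only [map_mul, Complex.conj_conj] at h1
  have h2 : (α * δ - β * γ) * conj (α * δ - β * γ) = 1 := by
    simp only [map_sub, map_mul]
    linear_combination (α * conj β) * h.cross + (β * conj α) * h1 + (α * conj α) * h.snd +
      (1 - β * conj β) * h.fst - h.mul_conj_eq
  rw [Complex.mul_conj'] at h2
  have h3 : ‖α * δ - β * γ‖ ^ 2 = 1 := by exact_mod_cast h2
  exact (pow_eq_one_iff_of_nonneg (norm_nonneg _) two_ne_zero).mp h3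

theorem det_ne_zero (h : IsUnitaryQuadruple α β γ δ) : α * δ - β * γ ≠ 0 := by
  rw [← norm_ne_zero_iff, h.norm_det]
  exact one_ne_zero

theorem moebius_symm_moebius (h : IsUnitaryQuadruple α β γ δ) {z : ℂ} (hz : z ∈ unitDisc) :
    moebius δ (-β) (-γ) α (moebius α β γ δ z) = z := by
  have h1 := h.denom_ne_zero hz
  have h2 := h.symm.denom_ne_zero (h.moebius_mem hz)
  have h3 : moebius α β γ δ z * (α + β * z) = γ + δ * z := div_mul_cancel₀ _ h1
  rw [moebius, div_eq_iff h2]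
  linear_combination h3

theorem hasDerivAt_moebius (h : IsUnitaryQuadruple α β γ δ) {z : ℂ} (hz : z ∈ unitDisc) :
    HasDerivAt (moebius α β γ δ) ((α * δ - β * γ) / (α + β * z) ^ 2) z := by
  have h1 : HasDerivAt (fun z => γ + δ * z) δ z := by
    simpa using ((hasDerivAt_id z).const_mul δ).const_add γ
  have h2 : HasDerivAt (fun z => α + β * z) β z := by
    simpa using ((hasDerivAt_id z).const_mul β).const_add α
  refine (h1.div h2 (h.denom_ne_zero hz)).congr_deriv ?_
  ring

theorem differentiableOn_moebius (h : IsUnitaryQuadruple α β γ δ) :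
    DifferentiableOn ℂ (moebius α β γ δ) unitDisc := fun _ hz =>
  (h.hasDerivAt_moebius hz).differentiableAt.differentiableWithinAt

/-- The automorphism of the disc given by a Moebius transformation. -/
def toDiscAut (h : IsUnitaryQuadruple α β γ δ) : DiscAut where
  toFun z := ⟨moebius α β γ δ z, h.moebius_mem z.2⟩
  invFun z := ⟨moebius δ (-β) (-γ) α z, h.symm.moebius_mem z.2⟩
  left_inv z := Subtype.ext (h.moebius_symm_moebius z.2)
  right_inv z := Subtype.ext (by
    have h1 := h.symm.moebius_symm_moebius z.2
    rwa [neg_neg, neg_neg] at h1)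
  holomorphic_toFun := IsHolomorphic.congr_ext h.differentiableOn_moebius fun _ => rfl
  holomorphic_invFun := IsHolomorphic.congr_ext h.symm.differentiableOn_moebius fun _ => rfl

theorem derivative_toDiscAut (h : IsUnitaryQuadruple α β γ δ) (z : unitDisc) :
    h.toDiscAut.derivative z = (α * δ - β * γ) / (α + β * z) ^ 2 := by
  refine ((h.hasDerivAt_moebius z.2).congr_of_eventuallyEq ?_).deriv
  filter_upwards [Metric.isOpen_ball.mem_nhds z.2] with w hw
  exact extendZero_apply (fun u => (h.toDiscAut u : ℂ)) ⟨w, hw⟩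

end IsUnitaryQuadruple

/-! ### Isometries between the weighted spaces -/

theorem LittleWeightedH.differentiableOn {U : Set ℂ} {v : Weight U} (f : LittleWeightedH v) :
    DifferentiableOn ℂ (extendZero f.1.1) U := f.1.2.1

/-- An open set on which an isometry between the weighted spaces is a weighted composition
operator preserving the weighted evaluations. -/
theorem exists_local_weighted_composition
    (T : LittleWeightedH discWeight →ₗᵢ[ℂ] LittleWeightedH discWeightSq) :
    ∃ h φ : ℂ → ℂ, ∃ q ∈ unitDisc, AnalyticAt ℂ h q ∧ AnalyticAt ℂ φ q ∧ h q ≠ 0 ∧ φ q ≠ 0 ∧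
      deriv φ q ≠ 0 ∧ ∀ᶠ z in 𝓝 q, ‖h z‖ * (1 - ‖z‖ ^ 2) = 1 - ‖φ z‖ ∧
        ∀ f : LittleWeightedH discWeight,
          extendZero (T f).1.1 z = h z * extendZero f.1.1 (φ z) := by
  let e : LittleWeightedH discWeight :=
    LittleWeightedH.ofEntire discWeight_le (fun _ => 1) (differentiable_const 1)
  let e' : LittleWeightedH discWeight :=
    LittleWeightedH.ofEntire discWeight_le (fun z => z) differentiable_id
  set h := extendZero (T e).1.1
  set k := extendZero (T e').1.1
  have hh : DifferentiableOn ℂ h unitDisc := LittleWeightedH.differentiableOn (T e)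
  have hk : DifferentiableOn ℂ k unitDisc := LittleWeightedH.differentiableOn (T e')
  set φ : ℂ → ℂ := fun z => k z / h z
  set Ω : Set ℂ := {z ∈ unitDisc | h z ≠ 0 ∧ k z ≠ 0}
  have hΩsub : Ω ⊆ unitDisc := fun z hz => hz.1
  have hΩ : IsOpen Ω := by
    rw [isOpen_iff_mem_nhds]
    rintro z ⟨hz, hz1, hz2⟩
    have hn := Metric.isOpen_ball.mem_nhds hz
    filter_upwards [hn, (hh.continuousOn.continuousAt hn).eventually_ne hz1,
      (hk.continuousOn.continuousAt hn).eventually_ne hz2] with w h1 h2 h3 using ⟨h1, h2, h3⟩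
  have hφ : DifferentiableOn ℂ φ Ω :=
    (hk.mono hΩsub).div (hh.mono hΩsub) fun z hz => hz.2.1
  set E : Set ℂ := {z ∈ Ω | ‖h z‖ * (1 - ‖z‖ ^ 2) = 1 - ‖φ z‖ ∧
    ∀ f : LittleWeightedH discWeight, extendZero (T f).1.1 z = h z * extendZero f.1.1 (φ z)}
  have hE : E ⊆ Ω := fun z hz => hz.1
  have hcl : ∀ z ∈ Ω, z ∈ closure E → z ∈ E := by
    intro z hz hzE
    have hne : (𝓝[E] z).NeBot := mem_closure_iff_nhdsWithin_neBot.mp hzE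
    have hzn := Metric.isOpen_ball.mem_nhds hz.1
    have hcont : ∀ f : ℂ → ℂ, DifferentiableOn ℂ f unitDisc → ContinuousAt f z := fun f hf =>
      hf.continuousOn.continuousAt hzn
    have hφz : ContinuousAt φ z := hφ.continuousOn.continuousAt (hΩ.mem_nhds hz)
    have hlim : ∀ {Y : Type} [TopologicalSpace Y] [T2Space Y] (A B : ℂ → Y), ContinuousAt A z →
        ContinuousAt B z → (∀ x ∈ E, A x = B x) → A z = B z := fun A B hA hB hAB =>
      tendsto_nhds_unique_of_eventuallyEq (hA.mono_left nhdsWithin_le_nhds)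
        (hB.mono_left nhdsWithin_le_nhds)
        (by filter_upwards [self_mem_nhdsWithin] with x hx using hAB x hx)
    have h1 : ‖h z‖ * (1 - ‖z‖ ^ 2) = 1 - ‖φ z‖ :=
      hlim (fun z => ‖h z‖ * (1 - ‖z‖ ^ 2)) (fun z => 1 - ‖φ z‖)
        ((hcont h hh).norm.mul (by fun_prop)) (continuousAt_const.sub hφz.norm) fun x hx => hx.2.1
    have hφD : φ z ∈ unitDisc := by
      rw [mem_ball_zero_iff]
      have h2 : 0 < ‖h z‖ := norm_pos_iff.mpr hz.2.1
      have h3 : ‖z‖ < 1 := mem_ball_zero_iff.mp hz.1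
      have h4 : 0 < 1 - ‖z‖ ^ 2 := by nlinarith [norm_nonneg z]
      linarith [mul_pos h2 h4]
    refine ⟨hz, h1, fun f => ?_⟩
    refine hlim (extendZero (T f).1.1) (fun z => h z * extendZero f.1.1 (φ z))
      (hcont _ (LittleWeightedH.differentiableOn (T f)))
      ((hcont h hh).mul (ContinuousAt.comp ?_ hφz)) fun x hx => hx.2.2 f
    exact (LittleWeightedH.differentiableOn f).continuousOn.continuousAt
      (Metric.isOpen_ball.mem_nhds hφD)
  have hcov : unitDisc \ {0} ⊆ φ '' E := by
    rintro p ⟨hp, hp0⟩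
    obtain ⟨f, hf, hf0⟩ := exists_peaksAt_discWeight ⟨p, hp⟩
    obtain ⟨q, hq, hqT⟩ := hf.exists_eval T (e := e) (fun _ => rfl) hf0
    have hext : ∀ f : LittleWeightedH discWeight, extendZero (T f).1.1 q = T f q := fun f =>
      extendZero_apply _ q
    have hhq : h q = T e q := hext e
    have hkq : k q = h q * p := by rw [hhq]; exact (hext e').trans (hqT e')
    have hq' : ‖h q‖ * (1 - ‖(q : ℂ)‖ ^ 2) = 1 - ‖p‖ := by
      rw [hhq, mul_comm]; exact hq
    have hhq0 : h q ≠ 0 := by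
      intro h0
      rw [h0, norm_zero, zero_mul] at hq'
      linarith [mem_ball_zero_iff.mp hp]
    have hφq : φ q = p := by
      change k q / h q = p
      rw [hkq, mul_div_cancel_left₀ _ hhq0]
    refine ⟨q, ⟨⟨q.2, hhq0, hkq ▸ mul_ne_zero hhq0 hp0⟩, hφq.symm ▸ hq', fun f => ?_⟩, hφq⟩
    rw [hφq, hext, hqT f, hhq, show extendZero f.1.1 p = f ⟨p, hp⟩ from
      extendZero_apply _ (⟨p, hp⟩ : unitDisc)]
  obtain ⟨q, hqE, hqd⟩ := exists_mem_interior_of_subset_image hΩ hφ hE hcl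
    (Metric.isOpen_ball.sdiff isClosed_singleton)
    ⟨1 / 2, by rw [mem_ball_zero_iff]; norm_num, by norm_num⟩ hcov
  have hqΩ := hE (interior_subset hqE)
  refine ⟨h, φ, q, hqΩ.1, hh.analyticOnNhd Metric.isOpen_ball q hqΩ.1,
    hφ.analyticOnNhd hΩ q hqΩ, hqΩ.2.1, div_ne_zero hqΩ.2.2 hqΩ.2.1, hqd, ?_⟩
  filter_upwards [mem_interior_iff_mem_nhds.mp hqE] with z hz using hz.2

theorem exists_weighted_composition
    (T : LittleWeightedH discWeight →ₗᵢ[ℂ] LittleWeightedH discWeightSq) :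
    ∃ (c : ℂ) (ψ : DiscAut), ‖c‖ = 1 ∧ ∀ (f : LittleWeightedH discWeight) (z : unitDisc),
      T f z = c * ψ.derivative z * f (discSq (ψ z)) := by
  obtain ⟨h, φ, q, hq, hh, hφ, h0, hφ0, hd, hev⟩ := exists_local_weighted_composition T
  obtain ⟨α, β, γ, δ, hu, hloc⟩ :=
    exists_unitary_of_norm_eq hh hφ h0 hφ0 hd (hev.mono fun z hz => hz.1)
  refine ⟨(α * δ - β * γ)⁻¹, hu.toDiscAut, by rw [norm_inv, hu.norm_det, inv_one], fun f z => ?_⟩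
  have hG : DifferentiableOn ℂ
      (fun z => ((α + β * z) ^ 2)⁻¹ * extendZero f.1.1 (moebius α β γ δ z ^ 2)) unitDisc := by
    refine DifferentiableOn.mul (DifferentiableOn.inv (by fun_prop) fun z hz =>
      pow_ne_zero 2 (hu.denom_ne_zero hz)) ?_
    exact DifferentiableOn.comp (t := unitDisc) (LittleWeightedH.differentiableOn f)
      (hu.differentiableOn_moebius.pow 2) fun z hz => (discSq ⟨_, hu.moebius_mem hz⟩).2
  have hEq := AnalyticOnNhd.eqOn_of_preconnected_of_eventuallyEq
    ((LittleWeightedH.differentiableOn (T f)).analyticOnNhd Metric.isOpen_ball)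
    (hG.analyticOnNhd Metric.isOpen_ball) (convex_ball 0 1).isPreconnected hq (by
      filter_upwards [hev, hloc] with z h1 h2
      have h3 : h z = ((α + β * z) ^ 2)⁻¹ := eq_inv_of_mul_eq_one_left h2.1
      rw [h1.2 f, h2.2, h3, moebius, div_pow, div_eq_inv_mul]) z.2
  dsimp only at hEq
  rw [extendZero_apply] at hEq
  rw [hEq, hu.derivative_toDiscAut, mul_div_assoc', inv_mul_cancel₀ hu.det_ne_zero, one_div]
  congr 1
  exact extendZero_apply f.1.1 (discSq (hu.toDiscAut z))

end

theorem theorem5p5 :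
    (∃ S : LittleWeightedH discWeight →ₗᵢ[ℂ] LittleWeightedH discWeightSq,
      (∀ (f : LittleWeightedH discWeight) (z : unitDisc), S f z = f (discSq z)) ∧
        ¬ Function.Surjective S) ∧
    ∀ T : LittleWeightedH discWeight →ₗᵢ[ℂ] LittleWeightedH discWeightSq,
      ∃ (c : ℂ) (ψ : DiscAut), ‖c‖ = 1 ∧
        ∀ (f : LittleWeightedH discWeight) (z : unitDisc),
          T f z = c * ψ.derivative z * f (discSq (ψ z)) :=
  ⟨⟨⟨compSq, norm_compSq⟩, fun _ _ => rfl, compSq_not_surjective⟩, exists_weighted_composition⟩
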